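/- **Theorem.** Let $\mathbb{F}$ be a field, $n,d\ge 0$ integers and $\epsilon>0$. A matrix $\mathbf{A}\in\mathbb{F}^{n\times n}$ is called *$\epsilon$-far from rank at most $d$* if at least $\epsilon n^2$ of its entries must be changed to obtain a matrix of rank at most $d$. A (randomized) *non-adaptive tester* chooses, possibly at random but independently of $\mathbf{A}$, a set of positions, reads the entries of $\mathbf{A}$ at these positions, and from these values and its internal randomness outputs $\mathsf{H0}$ or $\mathsf{H1}$. It *solves the rank testing problem with parameters $(n,d,\epsilon)$ over $\mathbb{F}$* if it outputs $\mathsf{H0}$ with probability $1$ whenever $\mathrm{rank}(\mathbf{A})\le d$, and outputs $\mathsf{H1}$ with probability at least $0.99$ whenever $\mathbf{A}$ is $\epsilon$-far from rank at most $d$. There are absolute constants $c>0$ and $\epsilon_0>0$ such that the following holds for every finite field $\mathbb{F}$, all integers $n,d\ge 0$ and every real $\epsilon>0$ with $d\le\sqrt{\epsilon}\,n$. Suppose that $\epsilon\le\epsilon_0$, or that at least one matrix in $\mathbb{F}^{n\times n}$ is $\epsilon$-far from rank at most $d$. Then any non-adaptive tester that solves the rank testing problem with parameters $(n,d,\epsilon)$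 over $\mathbb{F}$ and never reads more than $q$ entries satisfies $$q\ \ge\ c\,\frac{d^2}{\epsilon}.$$ -/

import Mathlib

namespace RankTesting

/-- The number of entries that have to be changed to turn `A` into `B`. -/
noncomputable def entryDist {F : Type*} {n : ℕ} (A B : Matrix (Fin n) (Fin n) F) : ℕ :=
  Set.ncard {p : Fin n × Fin n | A p.1 p.2 ≠ B p.1 p.2}

/-- `A` is `ε`-far from having rank at most `d`: at least `ε * n ^ 2` of its entries have to be
changed in order to obtain a matrix of rank at most `d`. -/
def IsFar {F : Type*} [Field F] {n : ℕ} (d : ℕ) (ε : ℝ) (A : Matrix (Fin n) (Fin n) F) : Prop :=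
  ∀ B : Matrix (Fin n) (Fin n) F, B.rank ≤ d → ε * (n : ℝ) ^ 2 ≤ (entryDist A B : ℝ)

/-- The two possible outputs of a tester: `H0` (rank at most `d`) and `H1` (far from it). -/
inductive Verdict
  | H0
  | H1

/-- A deterministic non-adaptive algorithm: a set of positions, fixed in advance, and a verdict
depending only on the entries read at these positions. -/
structure DetTester (F : Type*) (n : ℕ) where
  /-- the positions that are read -/
  queries : Finset (Fin n × Fin n)
  /-- the verdict as a function of the values read -/
  decision : (queries → F) → Verdict

/-- The output of a deterministic non-adaptive algorithm on the input matrix `A`. -/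
def DetTester.run {F : Type*} {n : ℕ} (t : DetTester F n) (A : Matrix (Fin n) (Fin n) F) :
    Verdict :=
  t.decision fun p => A p.1.1 p.1.2

/-- A (randomized) non-adaptive algorithm: a probability distribution over deterministic
non-adaptive algorithms.  For finite `F` the type `DetTester F n` is finite, so every source of
internal randomness is covered by a `PMF`. -/
abbrev Tester (F : Type*) (n : ℕ) := PMF (DetTester F n)

/-- The probability that the algorithm `T` outputs `v` on the input matrix `A`. -/
noncomputable def Tester.prob {F : Type*} {n : ℕ} (T : Tester F n)
    (A : Matrix (Fin n) (Fin n) F) (v : Verdict) : ENNReal :=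
  PMF.map (fun t => t.run A) T v

/-- `T` never reads more than `q` entries. -/
def Tester.QueriesAtMost {F : Type*} {n : ℕ} (T : Tester F n) (q : ℕ) : Prop :=
  ∀ t ∈ PMF.support T, t.queries.card ≤ q

/-- `T` solves the rank testing problem with parameters `(n, d, ε)`: it outputs `H0` with
probability `1` on every matrix of rank at most `d`, and `H1` with probability at least `0.99` on
every matrix that is `ε`-far from having rank at most `d`. -/
def Tester.Solves {F : Type*} [Field F] {n : ℕ} (T : Tester F n) (d : ℕ) (ε : ℝ) : Prop :=
  (∀ A : Matrix (Fin n) (Fin n) F, A.rank ≤ d → T.prob A Verdict.H0 = 1) ∧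
    ∀ A : Matrix (Fin n) (Fin n) F, IsFar d ε A → (99 / 100 : ENNReal) ≤ T.prob A Verdict.H1

end RankTesting

/-! A tester that never errs on low rank may answer `H1` only when the values read have no
completion of rank at most `d`. By `exists_completion`, any `d ^ 2 / 64` entries do have one: the
few heavy columns are repaired by a low-rank correction, the others are solved in a factorization
whose left factor comes from a union bound. The hard inputs are supported on a block of side `m`
about `32 √ε n`, far by counting (`exists_forall_lt_entryDist`), and shifted cyclically. An average
shift puts only `q m ^ 2 / n ^ 2` queries in the block (`sum_card_hits`), yet `H1` needs at least `d
^ 2 / 64` there, so `q` is at least of order `d ^ 2 n ^ 2 / m ^ 2`, that is `d ^ 2 / ε`. -/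

namespace RankTesting

open Matrix Finset

/-! ### Rank factorizations and a union bound over finite fields. -/

section LinearAlgebra

variable {F ι κ : Type*} [Field F]

lemma rank_add_le [Fintype κ] [Finite ι] (A B : Matrix ι κ F) :
    (A + B).rank ≤ A.rank + B.rank := by
  have := Fintype.ofFinite ι
  unfold Matrix.rank
  rw [Matrix.mulVecLin_add]
  calc _ ≤ Module.finrank F ↥(LinearMap.range A.mulVecLin ⊔ LinearMap.range B.mulVecLin) := by
        apply Submodule.finrank_mono
        rintro _ ⟨x, rfl⟩
        exact Submodule.add_mem_sup ⟨x, rfl⟩ ⟨x, rfl⟩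
    _ ≤ _ := Submodule.finrank_add_le_finrank_add_finrank _ _

/-- A rank factorization of a matrix of rank at most `d`. -/
lemma exists_mul_eq_of_rank_le [Fintype κ] [DecidableEq κ] [Finite ι] {d : ℕ} (B : Matrix ι κ F)
    (h : B.rank ≤ d) : ∃ (U : Matrix ι (Fin d) F) (V : Matrix (Fin d) κ F), U * V = B := by
  have := Fintype.ofFinite ι
  have h' : Module.finrank F (LinearMap.range B.mulVecLin) ≤ Module.finrank F (Fin d → F) := by
    rwa [Module.finrank_fin_fun]
  obtain ⟨f, hf⟩ := finrank_le_iff_exists_linearMap.mp h'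
  obtain ⟨g, hg⟩ := f.exists_leftInverse_of_injective (LinearMap.ker_eq_bot.mpr hf)
  refine ⟨LinearMap.toMatrix' ((LinearMap.range B.mulVecLin).subtype ∘ₗ g),
    LinearMap.toMatrix' (f ∘ₗ B.mulVecLin.rangeRestrict), ?_⟩
  rw [← LinearMap.toMatrix'_comp, LinearMap.comp_assoc, ← LinearMap.comp_assoc _ f g, hg,
    LinearMap.id_comp]
  exact LinearMap.toMatrix'_toLin' B

/-- Linearly independent vectors can be given arbitrary values by a linear functional. -/
lemma exists_functional_of_linearIndependent {V : Type*} [AddCommGroup V] [Module F V]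
    [Fintype ι] {u : ι → V} (hu : LinearIndependent F u) (a : ι → F) :
    ∃ f : V →ₗ[F] F, ∀ i, f (u i) = a i := by
  classical
  obtain ⟨g, hg⟩ := (Fintype.linearCombination F u).exists_leftInverse_of_injective
    (LinearMap.ker_eq_bot'.mpr fun c hc => funext (Fintype.linearIndependent_iff.mp hu c hc))
  refine ⟨Fintype.linearCombination F a ∘ₗ g, fun i => ?_⟩
  have h := LinearMap.congr_fun hg (Pi.single i 1)
  simp only [LinearMap.comp_apply, Fintype.linearCombination_apply_single, one_smul,
    LinearMap.id_apply] at h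
  simp [h, Fintype.linearCombination_apply_single]

variable [Fintype F] [Fintype ι] [Fintype κ]

open Classical in
/-- A nonzero vector is annihilated by few matrices. -/
lemma card_annihilated_mul_le {c : ι → F} (hc : c ≠ 0) :
    (univ.filter fun U : Matrix ι κ F => c ᵥ* U = 0).card * Fintype.card F ^ Fintype.card κ ≤
      Fintype.card (Matrix ι κ F) := by
  obtain ⟨i₀, hi₀⟩ := Function.ne_iff.mp hc
  rw [← Fintype.card_fun, ← Finset.card_univ (α := κ → F), ← Finset.card_product]
  -- As `c i₀ ≠ 0`, adding `T w` changes `c ᵥ* U` by a multiple of `w` that determines `w`; hence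
  -- translates of the annihilator by distinct `T w` are disjoint.
  let T : (κ → F) → Matrix ι κ F := fun w => vecMulVec (Pi.single i₀ 1) w
  have hT : ∀ w, c ᵥ* T w = c i₀ • w := fun w => by
    simp [T, vecMul_vecMulVec]
  refine Finset.card_le_card_of_injOn (fun p => p.1 + T p.2) (fun _ _ => Finset.mem_coe.mpr
    (Finset.mem_univ _)) ?_
  rintro ⟨U, w⟩ hU ⟨U', w'⟩ hU' h
  simp only [coe_product, Set.mem_prod, coe_filter, mem_univ, true_and, Set.mem_ofPred_eq,
    coe_univ, Set.mem_univ, and_true] at hU hU'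
  have h2 := congrArg (fun M => c ᵥ* M) h
  simp only [vecMul_add, hU, hU', hT, zero_add] at h2
  have hw : w = w' := smul_right_injective _ hi₀ h2
  subst hw
  simpa using h

/-- Few nonzero vectors have a common matrix annihilating none of them. -/
lemma exists_forall_vecMul_ne_zero (X : Finset (ι → F)) (h0 : 0 ∉ X)
    (hX : X.card < Fintype.card F ^ Fintype.card κ) :
    ∃ U : Matrix ι κ F, ∀ c ∈ X, c ᵥ* U ≠ 0 := by
  classical
  by_contra! hcon
  have hcover : (univ : Finset (Matrix ι κ F)) ⊆
      X.biUnion fun c => univ.filter fun U : Matrix ι κ F => c ᵥ* U = 0 := by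
    intro U _
    obtain ⟨c, hc, hcU⟩ := hcon U
    simp only [mem_biUnion, mem_filter, mem_univ, true_and]
    exact ⟨c, hc, hcU⟩
  have h1 := (card_le_card hcover).trans card_biUnion_le
  rw [card_univ] at h1
  have h2 : Fintype.card (Matrix ι κ F) * Fintype.card F ^ Fintype.card κ ≤
      X.card * Fintype.card (Matrix ι κ F) := by
    refine (Nat.mul_le_mul_right _ h1).trans ?_
    rw [sum_mul, ← smul_eq_mul, ← sum_const]
    exact sum_le_sum fun c hc => card_annihilated_mul_le (ne_of_mem_of_not_mem hc h0)
  rw [mul_comm] at h2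
  exact absurd (Nat.le_of_mul_le_mul_right h2 Fintype.card_pos) (not_le.mpr hX)

end LinearAlgebra

lemma succ_sq_le_four_mul_two_pow (f : ℕ) : (f + 1) ^ 2 ≤ 4 * 2 ^ f := by
  induction f with
  | zero => norm_num
  | succ f ih =>
    rcases Nat.lt_or_ge f 2 with h | h
    · interval_cases f <;> norm_num
    · rw [pow_succ 2]
      nlinarith

/-! ### Low-rank completion of sparse partial matrices. -/

section Completion

variable {F ι κ : Type*} [Field F] [Finite F] [Fintype ι] [Fintype κ]

/-- A partial matrix in which few entries of every column are specified has a completion of small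
rank. -/
lemma exists_completion_of_light_columns [DecidableEq ι] [DecidableEq κ]
    (A : Matrix ι κ F) (rows : κ → Finset ι) (J : Finset κ) {k f : ℕ}
    (hk : ∀ j, (rows j).card ≤ k) (hJ : ∀ j ∉ J, rows j = ∅) (hf : J.card < 2 ^ f) :
    ∃ B : Matrix ι κ F, B.rank ≤ k + f ∧ ∀ j, ∀ i ∈ rows j, B i j = A i j := by
  classical
  have := Fintype.ofFinite F
  have hs : 2 ≤ Fintype.card F := Fintype.one_lt_card
  -- Vectors supported on `rows j`: the possible coefficients of a dependency among those rows of
  -- `U`.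
  let S : κ → Finset (ι → F) := fun j =>
    Fintype.piFinset fun i => if i ∈ rows j then univ else {0}
  have hS : ∀ j, (S j).card ≤ Fintype.card F ^ k := by
    intro j
    have h1 : (S j).card = Fintype.card F ^ (rows j).card := by
      rw [Fintype.card_piFinset]
      calc _ = ∏ i, (if i ∈ rows j then Fintype.card F else 1) := by
            refine prod_congr rfl fun i _ => ?_
            split_ifs <;> simp
        _ = _ := by rw [prod_ite_mem, univ_inter, prod_const]
    rw [h1]
    exact Nat.pow_le_pow_right (by omega) (hk j)
  have hX : ((J.biUnion S).erase 0).card < Fintype.card F ^ Fintype.card (Fin (k + f)) := by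
    calc _ ≤ (J.biUnion S).card := card_erase_le
      _ ≤ J.card * Fintype.card F ^ k := card_biUnion_le_card_mul _ _ _ fun j _ => hS j
      _ < 2 ^ f * Fintype.card F ^ k := by gcongr
      _ ≤ Fintype.card F ^ f * Fintype.card F ^ k := by gcongr
      _ = _ := by rw [Fintype.card_fin, ← pow_add, add_comm]
  obtain ⟨U, hU⟩ := exists_forall_vecMul_ne_zero (κ := Fin (k + f)) _ (notMem_erase 0 _) hX
  have hind : ∀ j, LinearIndependent F fun i : rows j => U i := by
    intro j
    rw [Fintype.linearIndependent_iff]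
    intro g hg
    by_contra! hcon
    obtain ⟨i₀, hi₀⟩ := hcon
    let c : ι → F := fun i => if h : i ∈ rows j then g ⟨i, h⟩ else 0
    have hc : ∀ i : rows j, c i = g i := fun i => by simp [c]
    have hcX : c ∈ (J.biUnion S).erase 0 := by
      refine mem_erase.mpr ⟨fun h0 => hi₀ ?_, mem_biUnion.mpr ⟨j, ?_, ?_⟩⟩
      · rw [← hc, h0, Pi.zero_apply]
      · by_contra hj
        exact notMem_empty i₀.1 ((Finset.ext_iff.mp (hJ j hj) _).mp i₀.2)
      · refine Fintype.mem_piFinset.mpr fun i => ?_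
        by_cases h : i ∈ rows j <;> simp [h, c]
    apply hU c hcX
    rw [vecMul_eq_sum, ← hg]
    calc ∑ i, c i • U i = ∑ i ∈ rows j, c i • U i := by
          refine (sum_subset (subset_univ _) fun i _ hi => ?_).symm
          simp [c, hi]
      _ = ∑ i : rows j, c i • U i := (sum_coe_sort _ _).symm
      _ = _ := sum_congr rfl fun i _ => by rw [hc]
  choose φ hφ using fun j => exists_functional_of_linearIndependent (hind j) fun i => A i j
  -- Column `j` of the right factor solves the specified equations of column `j`, consistent by
  -- independence.
  refine ⟨U * Matrix.of fun l j => φ j (Pi.single l 1), ?_, fun j i hi => ?_⟩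
  · exact (rank_mul_le_left _ _).trans ((rank_le_card_width _).trans_eq (Fintype.card_fin _))
  · rw [← hφ j ⟨i, hi⟩, Matrix.mul_apply, LinearMap.pi_apply_eq_sum_univ (φ j) (U i)]
    refine sum_congr rfl fun l _ => ?_
    simp only [of_apply, smul_eq_mul]
    congr 2
    ext x
    simp [Pi.single_apply, eq_comm]

/-- Few entries of a matrix can be completed to a matrix of small rank. -/
lemma exists_completion (A : Matrix ι κ F) (Q : Finset (ι × κ)) {d : ℕ}
    (hQ : 64 * Q.card ≤ d ^ 2) :
    ∃ B : Matrix ι κ F, B.rank ≤ d ∧ ∀ p ∈ Q, B p.1 p.2 = A p.1 p.2 := by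
  classical
  let col : κ → Finset ι := fun j => univ.filter fun i => (i, j) ∈ Q
  have hcol : ∀ j, (col j).card ≤ (Q.filter fun p => p.2 = j).card := fun j =>
    card_le_card_of_injOn (fun i => (i, j)) (fun i hi => by simpa [col] using hi)
      fun i _ i' _ h => (Prod.mk.inj h).1
  -- Heavy columns, with more than `d / 2` specified entries. The rank budget is `d / 2 + d / 4` for
  -- the light columns plus `d / 32` for these.
  let H : Finset κ := univ.filter fun j => d < 2 * (col j).card
  have hH : 32 * H.card ≤ d := by
    have h1 : H.card * (d + 1) ≤ 2 * Q.card := by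
      calc H.card * (d + 1) ≤ ∑ j ∈ H, 2 * (Q.filter fun p => p.2 = j).card := by
            rw [← smul_eq_mul, ← sum_const]
            refine sum_le_sum fun j hj => ?_
            have h2 := (mem_filter.mp hj).2
            have h3 := hcol j
            omega
        _ ≤ ∑ j, 2 * (Q.filter fun p => p.2 = j).card := sum_le_sum_of_subset (subset_univ _)
        _ = 2 * Q.card := by
            rw [← mul_sum, card_eq_sum_card_fiberwise (f := Prod.snd) (s := Q) (t := univ)
              fun _ _ => by simp]
    by_contra! hcon
    nlinarith
  let rows : κ → Finset ι := fun j => if j ∈ H then ∅ else col j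
  have hrows : ∀ j, (rows j).card ≤ d / 2 := by
    intro j
    by_cases h : j ∈ H
    · simp [rows, h]
    · simp only [rows, if_neg h]
      simp only [H, mem_filter, mem_univ, true_and, not_lt] at h
      omega
  have hJ : ∀ j ∉ Q.image Prod.snd, rows j = ∅ := by
    intro j hj
    by_contra hne
    obtain ⟨i, hi⟩ := nonempty_iff_ne_empty.mpr hne
    by_cases h : j ∈ H
    · simp [rows, h] at hi
    · simp only [rows, if_neg h, col, mem_filter, mem_univ, true_and] at hi
      exact hj (mem_image.mpr ⟨_, hi, rfl⟩)
  have hf : (Q.image Prod.snd).card < 2 ^ (d / 4) := by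
    refine card_image_le.trans_lt ?_
    have h1 := succ_sq_le_four_mul_two_pow (d / 4)
    have h2 : d < 4 * (d / 4 + 1) := by omega
    have h3 : d ^ 2 < (4 * (d / 4 + 1)) ^ 2 := by gcongr
    rw [mul_pow] at h3
    omega
  obtain ⟨B, hB, hBA⟩ := exists_completion_of_light_columns A rows _ hrows hJ hf
  let δ : κ → F := fun j => if j ∈ H then 1 else 0
  have hδ : (diagonal δ).rank ≤ H.card := by
    refine rank_le_card_of_support_subset _ H fun j hj => ?_
    by_contra hjH
    apply hj
    ext l
    have hjH' : j ∉ H := hjH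
    simp [diagonal_apply, δ, hjH']
  -- This replaces the heavy columns of `B` by those of `A`.
  refine ⟨B + (A - B) * diagonal δ, ?_, ?_⟩
  · refine (rank_add_le _ _).trans ?_
    have h1 := (rank_mul_le_right (A - B) (diagonal δ)).trans hδ
    omega
  · rintro ⟨i, j⟩ hp
    rw [Matrix.add_apply, mul_diagonal]
    by_cases h : j ∈ H
    · simp [δ, h]
    · have : i ∈ rows j := by simp [rows, h, col, hp]
      simp [δ, h, hBA j i this]

end Completion

/-! ### Counting: matrices far from low rank. -/

/-- Bounds `2 * s - 1` by `s ^ (7 / 4)`, a saving over `s ^ 2` uniform in the field size. -/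
lemma pow_four_bound {s : ℕ} (hs : 2 ≤ s) : (2 * s - 1) ^ 4 ≤ s ^ 7 := by
  rcases hs.eq_or_lt with rfl | h
  · norm_num
  · calc (2 * s - 1) ^ 4 ≤ (2 * s) ^ 4 := by gcongr; omega
      _ = 16 * s ^ 4 := by ring
      _ ≤ s ^ 3 * s ^ 4 := by
        gcongr
        calc 16 ≤ 3 ^ 3 := by norm_num
          _ ≤ s ^ 3 := by gcongr; omega
      _ = s ^ 7 := by ring

/-- Generating function of the number of agreements with a fixed word. -/
lemma sum_pow_card_agree {F ι : Type*} [Fintype F] [Fintype ι] [DecidableEq ι] [DecidableEq F]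
    (b : ι → F) :
    ∑ a : ι → F, Fintype.card F ^ (univ.filter fun i => a i = b i).card =
      (2 * Fintype.card F - 1) ^ Fintype.card ι := by
  have h : ∀ i, ∑ x : F, (if x = b i then Fintype.card F else 1) = 2 * Fintype.card F - 1 := by
    intro i
    rw [← Finset.add_sum_erase _ _ (mem_univ (b i)), if_pos rfl,
      Finset.sum_congr rfl (fun x hx => if_neg (ne_of_mem_erase hx))]
    have : 0 < Fintype.card F := Fintype.card_pos_iff.mpr ⟨b i⟩
    simp only [sum_const, card_erase_of_mem (mem_univ _), card_univ, smul_eq_mul, mul_one]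
    omega
  calc _ = ∑ a : ι → F, ∏ i, (if a i = b i then Fintype.card F else 1) := by
        refine sum_congr rfl fun a _ => ?_
        rw [prod_ite, prod_const, prod_const_one, mul_one]
    _ = ∏ i, ∑ x : F, (if x = b i then Fintype.card F else 1) := by
        rw [prod_univ_sum, Fintype.piFinset_univ]
    _ = _ := by simp only [h, prod_const, card_univ]

/-- A Hamming ball is small. -/
lemma card_ball_mul_le {F ι : Type*} [Fintype F] [Fintype ι] [DecidableEq ι] [DecidableEq F]
    [Nonempty F]
    (b : ι → F) (t : ℕ) :
    (univ.filter fun a : ι → F => (univ.filter fun i => a i ≠ b i).card ≤ t).card *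
      Fintype.card F ^ (Fintype.card ι - t) ≤ (2 * Fintype.card F - 1) ^ Fintype.card ι := by
  rw [← sum_pow_card_agree b, ← smul_eq_mul, ← sum_const]
  -- Markov: each word in the ball has weight at least `s ^ (N - t)` in the generating function,
  -- with `s` the field size and `N` the length.
  refine (sum_le_sum fun a ha => ?_).trans (sum_le_sum_of_subset (subset_univ _))
  have h1 := (mem_filter.mp ha).2
  have h2 := card_filter_add_card_filter_not (s := (univ : Finset ι)) (fun i => a i = b i)
  rw [card_univ] at h2
  refine Nat.pow_le_pow_right Fintype.card_pos ?_
  simp only [ne_eq] at h1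
  convert (show Fintype.card ι - t ≤ (univ.filter fun i => a i = b i).card by omega)

lemma card_matrix {F ι κ : Type*} [Fintype F] [Fintype ι] [Fintype κ] [DecidableEq ι]
    [DecidableEq κ] [Fintype (Matrix ι κ F)] : Fintype.card (Matrix ι κ F) =
      (Fintype.card F ^ Fintype.card κ) ^ Fintype.card ι := by
  rw [← Fintype.card_fun, ← Fintype.card_fun]
  exact Fintype.card_congr Matrix.of.symm

lemma entryDist_eq_card {F : Type*} [DecidableEq F] {n : ℕ} (A B : Matrix (Fin n) (Fin n) F) :
    entryDist A B = (univ.filter fun p : Fin n × Fin n => A p.1 p.2 ≠ B p.1 p.2).card := by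
  rw [entryDist, ← Set.ncard_coe_finset]
  simp

/-- There are matrices far from all matrices of low rank. -/
lemma exists_forall_lt_entryDist {F : Type*} [Field F] [Finite F] {m d t : ℕ}
    (h : 4 * t + 8 * (m * d) < m ^ 2) :
    ∃ A : Matrix (Fin m) (Fin m) F, ∀ B : Matrix (Fin m) (Fin m) F, B.rank ≤ d →
      t < entryDist A B := by
  classical
  have := Fintype.ofFinite F
  by_contra! hcon
  set s := Fintype.card F with hs
  have hs2 : 2 ≤ s := Fintype.one_lt_card
  let ball : (Fin m × Fin m → F) → Finset (Fin m × Fin m → F) := fun b =>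
    univ.filter fun a => (univ.filter fun i => a i ≠ b i).card ≤ t
  let pr : (Matrix (Fin m) (Fin d) F × Matrix (Fin d) (Fin m) F) → (Fin m × Fin m → F) :=
    fun UV p => (UV.1 * UV.2) p.1 p.2
  -- Otherwise radius-`t` balls around the at most `s ^ (2 * m * d)` products `U * V` cover
  -- everything.
  have hcover : (univ : Finset (Fin m × Fin m → F)) ⊆ univ.biUnion fun UV => ball (pr UV) := by
    intro a _
    obtain ⟨B, hB, hAB⟩ := hcon (Matrix.of fun i j => a (i, j))
    obtain ⟨U, V, rfl⟩ := exists_mul_eq_of_rank_le B hB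
    rw [entryDist_eq_card] at hAB
    exact mem_biUnion.mpr ⟨(U, V), mem_univ _, mem_filter.mpr ⟨mem_univ _, hAB⟩⟩
  have h1 := (card_le_card hcover).trans card_biUnion_le
  have hM : Fintype.card (Fin m × Fin m) = m ^ 2 := by simp [sq]
  have h2 : s ^ m ^ 2 * s ^ (m ^ 2 - t) ≤ s ^ (2 * (m * d)) * (2 * s - 1) ^ m ^ 2 := by
    calc s ^ m ^ 2 * s ^ (m ^ 2 - t) ≤ (∑ UV, (ball (pr UV)).card) * s ^ (m ^ 2 - t) := by
          gcongr
          simpa [hM] using h1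
      _ ≤ ∑ UV : Matrix (Fin m) (Fin d) F × Matrix (Fin d) (Fin m) F, (2 * s - 1) ^ m ^ 2 := by
          rw [sum_mul]
          refine sum_le_sum fun UV _ => ?_
          have := card_ball_mul_le (pr UV) t
          rwa [hM] at this
      _ = _ := by
          rw [sum_const, card_univ, Fintype.card_prod, smul_eq_mul]
          congr 1
          rw [card_matrix, card_matrix, Fintype.card_fin, Fintype.card_fin, ← hs, ← pow_mul, ← pow_mul, ← pow_add]
          congr 1
          ring
  have h3 : s ^ (4 * (m ^ 2 + (m ^ 2 - t))) ≤ s ^ (8 * (m * d) + 7 * m ^ 2) := by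
    calc s ^ (4 * (m ^ 2 + (m ^ 2 - t))) = (s ^ m ^ 2 * s ^ (m ^ 2 - t)) ^ 4 := by
          rw [← pow_add, ← pow_mul, mul_comm]
      _ ≤ (s ^ (2 * (m * d)) * (2 * s - 1) ^ m ^ 2) ^ 4 := by gcongr
      _ = s ^ (8 * (m * d)) * ((2 * s - 1) ^ 4) ^ m ^ 2 := by
          rw [mul_pow, ← pow_mul, ← pow_mul, ← pow_mul]; congr 2 <;> ring
      _ ≤ s ^ (8 * (m * d)) * (s ^ 7) ^ m ^ 2 :=
          Nat.mul_le_mul_left _ (Nat.pow_le_pow_left (pow_four_bound hs2) _)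
      _ = _ := by rw [← pow_mul, ← pow_add]
  have h4 := (Nat.pow_le_pow_iff_right hs2).mp h3
  omega

/-! ### Shifts of a block-supported matrix and averaging. -/

section Shifts

variable {F : Type*} {n : ℕ}

/-- The matrix `P` with rows and columns shifted cyclically. -/
def shift (P : Matrix (Fin n) (Fin n) F) (s : Fin n × Fin n) : Matrix (Fin n) (Fin n) F :=
  fun i j => P (i + s.1) (j + s.2)

lemma card_filter_add_lt [NeZero n] {m : ℕ} (hm : m ≤ n) (i : Fin n) :
    (univ.filter fun s : Fin n => ((i + s : Fin n) : ℕ) < m).card = m := by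
  have h : (univ.filter fun s : Fin n => ((i + s : Fin n) : ℕ) < m).card =
      (univ.filter fun s : Fin n => (s : ℕ) < m).card := by
    refine card_equiv (Equiv.addLeft i) fun s => ?_
    simp
  rw [h, Fin.card_filter_val_lt, min_eq_right hm]

/-- The queried positions that a shift moves into the leading block of size `m`. -/
def hits (m : ℕ) (Q : Finset (Fin n × Fin n)) (s : Fin n × Fin n) : Finset (Fin n × Fin n) :=
  Q.filter fun p => ((p.1 + s.1 : Fin n) : ℕ) < m ∧ ((p.2 + s.2 : Fin n) : ℕ) < m

/-- Double counting: each queried position enters the block under exactly `m ^ 2` shifts. -/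
lemma sum_card_hits [NeZero n] {m : ℕ} (hm : m ≤ n) (Q : Finset (Fin n × Fin n)) :
    ∑ s, (hits m Q s).card = Q.card * m ^ 2 := by
  simp only [hits, card_filter]
  rw [sum_comm, ← smul_eq_mul, ← sum_const]
  refine sum_congr rfl fun p _ => ?_
  rw [← card_filter, ← univ_product_univ,
    filter_product (fun s : Fin n => ((p.1 + s : Fin n) : ℕ) < m)
      (fun s : Fin n => ((p.2 + s : Fin n) : ℕ) < m),
    card_product, card_filter_add_lt hm, card_filter_add_lt hm, sq]

lemma DetTester.run_congr {t : DetTester F n} {A B : Matrix (Fin n) (Fin n) F}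
    (h : ∀ p ∈ t.queries, A p.1 p.2 = B p.1 p.2) : t.run A = t.run B := by
  unfold DetTester.run
  congr 1
  funext p
  exact h p.1 p.2

variable [Field F]

lemma IsFar.shift [NeZero n] {d : ℕ} {ε : ℝ} {P : Matrix (Fin n) (Fin n) F} (hP : IsFar d ε P)
    (s : Fin n × Fin n) : IsFar d ε (shift P s) := by
  classical
  intro B hB
  refine (hP (B.submatrix (· - s.1) (· - s.2)) ((rank_submatrix_le _ _ _).trans hB)).trans ?_
  rw [entryDist_eq_card, entryDist_eq_card, Nat.cast_le]
  refine (card_equiv ((Equiv.subRight s.1).prodCongr (Equiv.subRight s.2)) fun p => ?_).le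
  rw [mem_filter, mem_filter]
  simp [RankTesting.shift]

/-- Probability exactly one forces the verdict on every deterministic tester in the support. -/
lemma Tester.Solves.run_eq_H0 {T : Tester F n} {d : ℕ} {ε : ℝ} (hT : T.Solves d ε)
    {t : DetTester F n} (ht : t ∈ PMF.support T) {A : Matrix (Fin n) (Fin n) F}
    (hA : A.rank ≤ d) : t.run A = Verdict.H0 := by
  have h := (PMF.apply_eq_one_iff _ _).mp (hT.1 A hA)
  rw [PMF.support_map] at h
  have h1 : t.run A ∈ (fun t : DetTester F n => t.run A) '' PMF.support T := ⟨t, ht, rfl⟩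
  rwa [h] at h1

/-- A one-sided tester needs many queries in the leading block to detect high rank. -/
lemma Tester.Solves.sq_le_card_hits [Finite F] {T : Tester F n} {d m : ℕ} {ε : ℝ}
    (hT : T.Solves d ε) {P : Matrix (Fin n) (Fin n) F}
    (hP : ∀ i j : Fin n, ¬((i : ℕ) < m ∧ (j : ℕ) < m) → P i j = 0)
    {t : DetTester F n} (ht : t ∈ PMF.support T) {s : Fin n × Fin n}
    (hrun : t.run (shift P s) = Verdict.H1) : d ^ 2 ≤ 64 * (hits m t.queries s).card := by
  by_contra! hcon
  obtain ⟨B, hB, hBP⟩ := exists_completion (shift P s) (hits m t.queries s) hcon.le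
  -- Masking by these diagonals zeroes the completion outside the shifted block without raising its
  -- rank, so it agrees with the input on all queries.
  let δ : Fin n → Fin n → F := fun a i => if ((i + a : Fin n) : ℕ) < m then 1 else 0
  have hrank : (diagonal (δ s.1) * B * diagonal (δ s.2)).rank ≤ d :=
    ((rank_mul_le_left _ _).trans (rank_mul_le_right _ _)).trans hB
  have h0 := hT.run_eq_H0 ht hrank
  have hcongr : t.run (shift P s) = t.run (diagonal (δ s.1) * B * diagonal (δ s.2)) := by
    refine DetTester.run_congr fun p hp => ?_
    rw [mul_diagonal, diagonal_mul]
    by_cases h : ((p.1 + s.1 : Fin n) : ℕ) < m ∧ ((p.2 + s.2 : Fin n) : ℕ) < m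
    · rw [hBP p (mem_filter.mpr ⟨hp, h⟩)]
      simp [δ, h.1, h.2]
    · rw [show shift P s p.1 p.2 = 0 from hP _ _ h]
      rcases not_and_or.mp h with h | h <;> simp [δ, h]
  rw [hrun, h0] at hcongr
  exact Verdict.noConfusion hcongr

/-- Averaging over all shifts of a far matrix supported in the leading block of size `m`. -/
lemma Tester.Solves.sq_mul_sq_le [Finite F] {T : Tester F n} {d m q : ℕ} {ε : ℝ}
    (hT : T.Solves d ε) (hq : T.QueriesAtMost q) (hm : m ≤ n) {P : Matrix (Fin n) (Fin n) F}
    (hP : ∀ i j : Fin n, ¬((i : ℕ) < m ∧ (j : ℕ) < m) → P i j = 0) (hfar : IsFar d ε P) :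
    (99 / 100 : ℝ) * ((n : ℝ) ^ 2 * (d : ℝ) ^ 2) ≤ 64 * ((q : ℝ) * (m : ℝ) ^ 2) := by
  rcases Nat.eq_zero_or_pos n with rfl | hn
  · simp; positivity
  have : NeZero n := ⟨hn.ne'⟩
  -- For each shift, at least 0.99 of the mass of `T` answers `H1`, and each such `t` has many hits.
  have hs : ∀ s, (99 / 100 : ENNReal) * (d : ENNReal) ^ 2 ≤
      ∑' t, T t * (64 * ((hits m t.queries s).card : ENNReal)) := by
    intro s
    refine (mul_le_mul_left (hT.2 _ (hfar.shift s)) _).trans ?_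
    rw [Tester.prob, PMF.map_apply, ← ENNReal.tsum_mul_right]
    refine ENNReal.tsum_le_tsum fun t => ?_
    split_ifs with h
    · by_cases ht : t ∈ PMF.support T
      · gcongr
        exact_mod_cast hT.sq_le_card_hits hP ht h.symm
      · simp [(PMF.apply_eq_zero_iff _ _).mpr ht]
    · simp
  have hsum : (n : ENNReal) ^ 2 * ((99 / 100 : ENNReal) * (d : ENNReal) ^ 2) ≤
      64 * ((q : ENNReal) * (m : ENNReal) ^ 2) := by
    calc (n : ENNReal) ^ 2 * ((99 / 100 : ENNReal) * (d : ENNReal) ^ 2)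
        = ∑ _s : Fin n × Fin n, (99 / 100 : ENNReal) * (d : ENNReal) ^ 2 := by
          rw [sum_const, card_univ, Fintype.card_prod, Fintype.card_fin, nsmul_eq_mul, sq]
          push_cast
          rfl
      _ ≤ ∑ s : Fin n × Fin n, ∑' t, T t * (64 * ((hits m t.queries s).card : ENNReal)) :=
          sum_le_sum fun s _ => hs s
      _ = ∑' t, ∑ s : Fin n × Fin n, T t * (64 * ((hits m t.queries s).card : ENNReal)) :=
          (Summable.tsum_finsetSum fun _ _ => ENNReal.summable).symm
      _ = ∑' t, T t * (64 * ((t.queries.card : ENNReal) * (m : ENNReal) ^ 2)) := by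
          refine tsum_congr fun t => ?_
          rw [← mul_sum, ← mul_sum, ← Nat.cast_sum, sum_card_hits hm]
          push_cast
          rfl
      _ ≤ ∑' t, T t * (64 * ((q : ENNReal) * (m : ENNReal) ^ 2)) := by
          refine ENNReal.tsum_le_tsum fun t => ?_
          by_cases ht : t ∈ PMF.support T
          · gcongr
            exact hq t ht
          · simp [(PMF.apply_eq_zero_iff _ _).mpr ht]
      _ = _ := by rw [ENNReal.tsum_mul_right, PMF.tsum_coe, one_mul]
  have hreal := ENNReal.toReal_mono (by finiteness) hsum
  simp only [ENNReal.toReal_mul, ENNReal.toReal_pow, ENNReal.toReal_natCast, ENNReal.toReal_div,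
    ENNReal.toReal_ofNat] at hreal
  linarith

end Shifts

/-! ### Assembling the lower bound. -/

/-- A matrix far from rank at most `d`, supported in the leading block of size `m`. -/
lemma exists_isFar_supported {F : Type*} [Field F] [Finite F] {n m d : ℕ} {ε : ℝ} (hm : m ≤ n)
    (hm0 : 0 < m) (hd : 16 * d ≤ m) (hε : 16 * (ε * (n : ℝ) ^ 2) ≤ (m : ℝ) ^ 2) :
    ∃ P : Matrix (Fin n) (Fin n) F,
      (∀ i j : Fin n, ¬((i : ℕ) < m ∧ (j : ℕ) < m) → P i j = 0) ∧ IsFar d ε P := by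
  classical
  obtain ⟨A, hA⟩ := exists_forall_lt_entryDist (F := F) (m := m) (d := d) (t := m ^ 2 / 16) (by
    have h1 : 16 * (m * d) ≤ m ^ 2 := by nlinarith
    have h2 : 0 < m ^ 2 := by positivity
    omega)
  refine ⟨fun i j => if h : (i : ℕ) < m ∧ (j : ℕ) < m then A ⟨i, h.1⟩ ⟨j, h.2⟩ else 0,
    fun i j h => dif_neg h, fun B hB => ?_⟩
  have h1 := hA (B.submatrix (Fin.castLE hm) (Fin.castLE hm))
    ((rank_submatrix_le _ _ _).trans hB)
  set P : Matrix (Fin n) (Fin n) F :=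
    fun i j => if h : (i : ℕ) < m ∧ (j : ℕ) < m then A ⟨i, h.1⟩ ⟨j, h.2⟩ else 0
  have h2 : entryDist A (B.submatrix (Fin.castLE hm) (Fin.castLE hm)) ≤ entryDist P B := by
    rw [entryDist_eq_card, entryDist_eq_card]
    refine card_le_card_of_injOn (Prod.map (Fin.castLE hm) (Fin.castLE hm)) (fun p hp => ?_)
      ((Fin.castLE_injective hm).prodMap (Fin.castLE_injective hm)).injOn
    rw [mem_coe, mem_filter] at hp ⊢
    simpa [P] using hp
  have h3 : m ^ 2 < 16 * entryDist P B := by omega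
  have h4 : (m : ℝ) ^ 2 < 16 * (entryDist P B : ℝ) := by exact_mod_cast h3
  linarith

end RankTesting

theorem mainTheorem2 :
    ∃ c ε₀ : ℝ, 0 < c ∧ 0 < ε₀ ∧
      ∀ (F : Type*) [Field F] [Finite F] (n d : ℕ) (ε : ℝ), 0 < ε →
        (d : ℝ) ≤ Real.sqrt ε * (n : ℝ) →
        (ε ≤ ε₀ ∨ ∃ A : Matrix (Fin n) (Fin n) F, RankTesting.IsFar d ε A) →
        ∀ (T : RankTesting.Tester F n) (q : ℕ),
          T.Solves d ε → T.QueriesAtMost q → c * ((d : ℝ) ^ 2 / ε) ≤ (q : ℝ) := by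
  refine ⟨1 / 100000, 1 / 1024, by norm_num, by norm_num, ?_⟩
  intro F _ _ n d ε hε hd hor T q hT hq
  rcases Nat.eq_zero_or_pos d with rfl | hd0
  · simp
  have hx1 : 1 ≤ Real.sqrt ε * n := le_trans (by exact_mod_cast hd0) hd
  have hn : (0 : ℝ) < n := by
    by_contra! h
    have := mul_nonpos_of_nonneg_of_nonpos (Real.sqrt_nonneg ε) h
    linarith
  have hxx : (Real.sqrt ε * n) ^ 2 = ε * n ^ 2 := by rw [mul_pow, Real.sq_sqrt hε.le]
  rw [mul_div_assoc', div_le_iff₀ hε]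
  rcases le_or_gt ε (1 / 1024) with hsmall | hlarge
  · have hsqrt : Real.sqrt ε ≤ 1 / 32 := by
      rw [Real.sqrt_le_left (by norm_num)]
      norm_num at hsmall ⊢
      exact hsmall
    obtain ⟨x, hx⟩ : ∃ x, x = Real.sqrt ε * n := ⟨_, rfl⟩
    rw [← hx] at hx1 hd hxx
    have hfl : (⌊32 * x⌋₊ : ℝ) ≤ 32 * x := Nat.floor_le (by linarith)
    have hfl' : 32 * x < ⌊32 * x⌋₊ + 1 := Nat.lt_floor_add_one _
    -- `ε ≤ 1 / 1024` gives `m ≤ n`; `x ≥ 1` absorbs the rounding, so `m ≥ 31 * x`, enough for `16 *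
    -- d ≤ m` and farness.
    obtain ⟨m, hm⟩ : ∃ m, m = ⌊32 * x⌋₊ := ⟨_, rfl⟩
    rw [← hm] at hfl hfl'
    have hmn : m ≤ n := by
      have : (m : ℝ) ≤ n := by nlinarith
      exact_mod_cast this
    have hm0 : 0 < m := by
      have : (0 : ℝ) < m := by linarith
      exact_mod_cast this
    have hdm : 16 * d ≤ m := by
      have : 16 * (d : ℝ) ≤ m := by linarith
      exact_mod_cast this
    obtain ⟨P, hP, hfar⟩ := RankTesting.exists_isFar_supported (F := F) (ε := ε) hmn hm0 hdm
      (by rw [← hxx]; nlinarith)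
    have h := hT.sq_mul_sq_le hq hmn hP hfar
    have hm2 : (m : ℝ) ^ 2 ≤ 1024 * (ε * n ^ 2) := by
      rw [← hxx]
      nlinarith
    have h1 : (q : ℝ) * (m : ℝ) ^ 2 ≤ q * (1024 * (ε * n ^ 2)) := by gcongr
    have h2 : (n : ℝ) ^ 2 * ((99 / 100) * (d : ℝ) ^ 2) ≤ (n : ℝ) ^ 2 * (65536 * (q * ε)) := by
      linarith
    have h3 := le_of_mul_le_mul_left h2 (by positivity)
    nlinarith [mul_nonneg (Nat.cast_nonneg (α := ℝ) q) hε.le]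
  -- For large `ε` the given far matrix serves, with the whole matrix as block.
  · obtain ⟨A, hA⟩ := hor.resolve_left (not_le.mpr hlarge)
    have h := hT.sq_mul_sq_le hq le_rfl (fun i j h => absurd ⟨i.2, j.2⟩ h) hA
    have h2 : (n : ℝ) ^ 2 * ((99 / 100) * (d : ℝ) ^ 2) ≤ (n : ℝ) ^ 2 * (64 * q) := by linarith
    have h3 := le_of_mul_le_mul_left h2 (by positivity)
    have h4 : (q : ℝ) * (1 / 1024) ≤ q * ε := by gcongr
    linarith
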